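/- Let $(\mathcal X,\rho)$ be a complete separable metric space, and let $T=\mathbb N_+=\{1,2,\dots\}$ or $T=\mathbb R_+=[0,\infty)$. A Markov operator is a map $P$ from the finite Borel measures on $\mathcal X$ to themselves with $P(\lambda_1\mu_1+\lambda_2\mu_2)=\lambda_1P\mu_1+\lambda_2P\mu_2$ for $\lambda_1,\lambda_2\ge 0$ and $P\mu(\mathcal X)=\mu(\mathcal X)$. It is a Markov–Feller operator if there is a linear operator on the bounded Borel functions, $f\mapsto Pf$, with $\int f\,d(P\mu)=\int Pf\,d\mu$ for all bounded Borel $f$ and all finite Borel measures $\mu$, and if this operator maps $C_b(\mathcal X)$ into itself; then $Pf(x)=\int f\,d(P\delta_x)$. A Markov–Feller semigroup $\{P_t\}_{t\in T}$ is a family of Markov–Feller operators with $P_{s+t}=P_sP_t$ for all $s,t\in T$. Let $\{P_t\}_{t\in T}$ be a Markov–Feller semigroup on $\mathcal X$ that is eventually continuous at every $z\in\mathcal X$, that is, for every bounded Lipschitz function $f:\mathcal X\to\mathbb R$, $$\limsup_{x\to z}\ \limsup_{t\to\infty}|P_tf(x)-P_tf(z)|=0 .$$ If $T=\mathbb R_+$,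 assume also that $\{P_t\}$ is strongly continuous on $C_b(\mathcal X)$, that is, $\lim_{t\searrow 0}\|P_tf-f\|_\infty=0$ for every $f\in C_b(\mathcal X)$. Let $\mu$ be an ergodic measure for $\{P_t\}_{t\in T}$, that is, a Borel probability measure with $P_t\mu=\mu$ for all $t\in T$ such that $\mu(A)\in\{0,1\}$ for every Borel set $A$ satisfying $P_t\mathbf 1_A=\mathbf 1_A$ $\mu$-almost everywhere for all $t\in T$. Let $\operatorname{supp}\mu=\{x:\mu(B(x,\epsilon))>0\text{ for every }\epsilon>0\}$. If the interior of $\operatorname{supp}\mu$ in $\mathcal X$ is nonempty, then $\{P_t\}_{t\in T}$ satisfies the e-property at every point $z$ of that interior: for every bounded Lipschitz function $f:\mathcal X\to\mathbb R$, $$\limsup_{x\to z}\ \sup_{t\in T}|P_tf(x)-P_tf(z)|=0 .$$ -/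

import Mathlib

open MeasureTheory Filter Topology
open scoped NNReal BoundedContinuousFunction

noncomputable section

namespace MarkovFeller

variable {X : Type*} [MeasurableSpace X]

/-- A Markov operator on finite measures: positively linear and preserving the total mass. -/
structure IsMarkovOperator (P : FiniteMeasure X → FiniteMeasure X) : Prop where
  linear : ∀ (a b : ℝ≥0) (μ ν : FiniteMeasure X), P (a • μ + b • ν) = a • P μ + b • P ν
  mass_eq : ∀ μ : FiniteMeasure X, (P μ).mass = μ.mass

/-- The linear space `B_b(X)` of bounded measurable real functions. -/
def boundedMeasurable (X : Type*) [MeasurableSpace X] : Submodule ℝ (X → ℝ) where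
  carrier := {f | Measurable f ∧ ∃ C : ℝ, ∀ x, |f x| ≤ C}
  add_mem' := by
    rintro f g ⟨hf, C, hC⟩ ⟨hg, D, hD⟩
    exact ⟨hf.add hg, C + D, fun x => (abs_add_le _ _).trans (add_le_add (hC x) (hD x))⟩
  zero_mem' := ⟨measurable_const, 0, fun x => by simp⟩
  smul_mem' := by
    rintro c f ⟨hf, C, hC⟩
    refine ⟨hf.const_smul c, |c| * C, fun x => ?_⟩
    simp only [Pi.smul_apply, smul_eq_mul, abs_mul]
    exact mul_le_mul_of_nonneg_left (hC x) (abs_nonneg c)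

/-- A linear operator `D` on `B_b(X)` is a dual of `P` if `⟨f, P μ⟩ = ⟨D f, μ⟩` for all `f`, `μ`. -/
def IsDual (P : FiniteMeasure X → FiniteMeasure X)
    (D : boundedMeasurable X →ₗ[ℝ] boundedMeasurable X) : Prop :=
  ∀ (f : boundedMeasurable X) (μ : FiniteMeasure X),
    ∫ x, f.1 x ∂(P μ : Measure X) = ∫ x, (D f).1 x ∂(μ : Measure X)

/-- `P` is regular if it has a dual operator on `B_b(X)`. -/
def IsRegular (P : FiniteMeasure X → FiniteMeasure X) : Prop :=
  ∃ D : boundedMeasurable X →ₗ[ℝ] boundedMeasurable X, IsDual P D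

/-- The function `P f`, `P f (x) = ⟨f, P δ_x⟩`. For a regular `P` and `f ∈ B_b(X)` this is the value
at `f` of the (hence unique) dual operator of `P`, see `IsDual.eq_act`. -/
def act (P : FiniteMeasure X → FiniteMeasure X) (f : X → ℝ) (x : X) : ℝ :=
  ∫ y, f y ∂(P (diracProba x).toFiniteMeasure : Measure X)

theorem IsDual.eq_act {P : FiniteMeasure X → FiniteMeasure X}
    {D : boundedMeasurable X →ₗ[ℝ] boundedMeasurable X} (h : IsDual P D)
    (f : boundedMeasurable X) : (D f).1 = act P f.1 := by
  funext x
  have hx := h f (diracProba x).toFiniteMeasure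
  have hd : (((diracProba x).toFiniteMeasure : FiniteMeasure X) : Measure X)
      = Measure.dirac x := rfl
  rw [hd, integral_dirac' _ _ (D f).2.1.stronglyMeasurable] at hx
  exact hx.symm

/-- `f` is a bounded Lipschitz function. -/
def IsBoundedLipschitz {X : Type*} [MetricSpace X] (f : X → ℝ) : Prop :=
  (∃ K : ℝ≥0, LipschitzWith K f) ∧ ∃ C : ℝ, ∀ x, |f x| ≤ C

/-- A Markov-Feller operator: a regular Markov operator whose dual leaves `C_b(X)` invariant. -/
structure IsMarkovFellerOperator [TopologicalSpace X]
    (P : FiniteMeasure X → FiniteMeasure X) : Prop where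
  markov : IsMarkovOperator P
  regular : IsRegular P
  feller : ∀ f : X →ᵇ ℝ, ∃ g : X →ᵇ ℝ, ∀ x, g x = act P f x

/-- A Markov-Feller semigroup with time set `T` (which is `ℕ+` or `ℝ≥0` below). For `T = ℝ≥0`, the
identity `P 0 = id` is a consequence of strong continuity on `C_b(X)` and need not be required. -/
structure IsMarkovFellerSemigroup [TopologicalSpace X] {T : Type*} [Add T]
    (P : T → FiniteMeasure X → FiniteMeasure X) : Prop where
  markovFeller : ∀ t, IsMarkovFellerOperator (P t)
  semigroup : ∀ s t, P (s + t) = P s ∘ P t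

/-- Strong continuity on `C_b(X)`: `‖P_t f - f‖_∞ → 0` as `t ↘ 0`, for all `f ∈ C_b(X)`. -/
def IsStronglyContinuous [TopologicalSpace X]
    (P : ℝ≥0 → FiniteMeasure X → FiniteMeasure X) : Prop :=
  ∀ f : X →ᵇ ℝ, TendstoUniformly (fun t : ℝ≥0 => act (P t) f) f (𝓝[>] 0)

/-- `μ` is an ergodic measure: an invariant probability measure such that every measurable set `A`
with `P_t 1_A = 1_A` `μ`-a.e. for all `t` has measure `0` or `1`. -/
structure IsErgodicMeasure {T : Type*} (P : T → FiniteMeasure X → FiniteMeasure X)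
    (μ : ProbabilityMeasure X) : Prop where
  invariant : ∀ t, P t μ.toFiniteMeasure = μ.toFiniteMeasure
  zero_or_one : ∀ A : Set X, MeasurableSet A →
    (∀ t, act (P t) (A.indicator fun _ => (1 : ℝ)) =ᵐ[(μ : Measure X)]
      A.indicator fun _ => (1 : ℝ)) →
    (μ : Measure X) A = 0 ∨ (μ : Measure X) A = 1

/-- Eventual continuity at `z`. -/
def IsEventuallyContinuousAt {X : Type*} [MeasurableSpace X] [MetricSpace X] {T : Type*} [LE T]
    (P : T → FiniteMeasure X → FiniteMeasure X) (z : X) : Prop :=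
  ∀ f : X → ℝ, IsBoundedLipschitz f → ∀ ε > 0, ∃ δ > 0, ∀ x ∈ Metric.ball z δ,
    ∃ t₀ : T, ∀ t, t₀ ≤ t → |act (P t) f x - act (P t) f z| < ε

/-- The e-property at `z`. -/
def HasEPropertyAt {X : Type*} [MeasurableSpace X] [MetricSpace X] {T : Type*}
    (P : T → FiniteMeasure X → FiniteMeasure X) (z : X) : Prop :=
  ∀ f : X → ℝ, IsBoundedLipschitz f → ∀ ε > 0, ∃ δ > 0, ∀ x ∈ Metric.ball z δ,
    ∀ t : T, |act (P t) f x - act (P t) f z| < ε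

end MarkovFeller

end

/-!
The e-property at `z` is a statement about the asymptotic oscillation of a bounded Lipschitz
function `f`: the infimum `ω(z)` of the radii `r` such that, near `z` and for all large times,
`P_t f` stays within `r` of a constant (`MarkovFeller.IsNearlyConstantAt`). If `ω(z) = 0`, then
`|P_t f(x) - P_t f(z)|` is small for `x` near `z` and all large `t`, and bounded times are dealt
with by the Feller property, together with strong continuity when time is continuous. Three facts
show that `ω = 0` on the support of the ergodic measure `μ`.

* `ω` takes arbitrarily small values on the support, by eventual continuity and the Baire category
  theorem in the interior of the support (`MarkovFeller.exists_isNearlyConstantAt`).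
* `ω` is subharmonic: since `P_{s+t} f = P_s (P_t f)`, the oscillation at `z` is at most the
  average of `ω` under `P_s δ_z`. What is needed is the version for two levels: if `ω ≤ r` almost
  everywhere for `P_s δ_z`, and `ω ≤ ε` where a continuous weight `φ` with values in `[0, 1]` is
  nonzero, then `ω(z) ≤ ε P_s φ(z) + r (1 - P_s φ(z))` (`MarkovFeller.IsNearlyConstantAt.of_act`).
* Points of the support visit every ball around a point of the support, with a probability bounded
  below independently of the starting point, at some time that depends on it
  (`MarkovFeller.exists_lt_act_of_mem_support`). This is where ergodicity enters: the function
  `limsup_t P_t φ` is bounded and subharmonic, hence almost surely at least the mean of `φ`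
  (`MarkovFeller.IsErgodicMeasure.measure_lt_eq_zero`), and eventual continuity extends the
  resulting bound to all points of the support.

With `M` the supremum of `ω` over the support, which is absorbing, and `ε > 0` arbitrary, these give
`M ≤ α ε + (1 - α) M` for some `α > 0`, so `M ≤ ε`.
-/

namespace MarkovFeller

/-! ### Markov–Feller operators as integrals against transition probabilities -/

section Basic

theorem abs_le_one_of_mem_unit {X : Type*} {χ : X → ℝ} (h0 : ∀ x, 0 ≤ χ x) (h1 : ∀ x, χ x ≤ 1)
    (x : X) : |χ x| ≤ 1 := by
  rw [abs_of_nonneg (h0 x)]; exact h1 x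

variable {X : Type*} [MeasurableSpace X]

/-- The transition probability `P δ_x`, as a measure. By definition `act P f x` is the integral of
`f` against it. -/
noncomputable def transition (P : FiniteMeasure X → FiniteMeasure X) (x : X) : Measure X :=
  (P (diracProba x).toFiniteMeasure : Measure X)

theorem act_def (P : FiniteMeasure X → FiniteMeasure X) (f : X → ℝ) (x : X) :
    act P f x = ∫ y, f y ∂(transition P x) := rfl

theorem IsMarkovOperator.isProbabilityMeasure {P : FiniteMeasure X → FiniteMeasure X}
    (h : IsMarkovOperator P) (x : X) : IsProbabilityMeasure (transition P x) := by
  constructor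
  have h1 := h.mass_eq (diracProba x).toFiniteMeasure
  have h2 : ((P (diracProba x).toFiniteMeasure).mass : ENNReal) = 1 := by
    rw [h1, ProbabilityMeasure.mass_toFiniteMeasure]; rfl
  rw [← h2, FiniteMeasure.ennreal_mass]
  rfl

theorem integrable_of_mem_boundedMeasurable {ν : Measure X} [IsFiniteMeasure ν] {f : X → ℝ}
    (hf : f ∈ boundedMeasurable X) : Integrable f ν := by
  obtain ⟨hm, C, hC⟩ := hf
  exact Integrable.of_bound hm.aestronglyMeasurable C (ae_of_all _ hC)

theorem const_mem_boundedMeasurable (c : ℝ) : (fun _ : X => c) ∈ boundedMeasurable X :=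
  ⟨measurable_const, |c|, fun _ => le_rfl⟩

theorem const_mul_mem_boundedMeasurable (c : ℝ) {f : X → ℝ} (hf : f ∈ boundedMeasurable X) :
    (fun x => c * f x) ∈ boundedMeasurable X :=
  (boundedMeasurable X).smul_mem c hf

theorem mul_mem_boundedMeasurable {f g : X → ℝ} (hf : f ∈ boundedMeasurable X)
    (hg : g ∈ boundedMeasurable X) : (fun x => f x * g x) ∈ boundedMeasurable X := by
  obtain ⟨hfm, C, hC⟩ := hf
  obtain ⟨hgm, D, hD⟩ := hg
  refine ⟨hfm.mul hgm, C * D, fun x => ?_⟩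
  rw [abs_mul]
  exact mul_le_mul (hC x) (hD x) (abs_nonneg _) ((abs_nonneg _).trans (hC x))

theorem max_mem_boundedMeasurable {f g : X → ℝ} (hf : f ∈ boundedMeasurable X)
    (hg : g ∈ boundedMeasurable X) : (fun x => max (f x) (g x)) ∈ boundedMeasurable X := by
  obtain ⟨hfm, C, hC⟩ := hf
  obtain ⟨hgm, D, hD⟩ := hg
  exact ⟨hfm.max hgm, max C D,
    fun x => abs_max_le_max_abs_abs.trans (max_le_max (hC x) (hD x))⟩

theorem min_mem_boundedMeasurable {f g : X → ℝ} (hf : f ∈ boundedMeasurable X)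
    (hg : g ∈ boundedMeasurable X) : (fun x => min (f x) (g x)) ∈ boundedMeasurable X := by
  obtain ⟨hfm, C, hC⟩ := hf
  obtain ⟨hgm, D, hD⟩ := hg
  exact ⟨hfm.min hgm, max C D,
    fun x => abs_min_le_max_abs_abs.trans (max_le_max (hC x) (hD x))⟩

theorem mem_boundedMeasurable_of_continuous [TopologicalSpace X] [BorelSpace X] {f : X → ℝ}
    (hf : Continuous f) {C : ℝ} (hC : ∀ x, |f x| ≤ C) : f ∈ boundedMeasurable X :=
  ⟨hf.measurable, C, hC⟩

variable {P : FiniteMeasure X → FiniteMeasure X}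

theorem act_mem_boundedMeasurable (h : IsRegular P) {f : X → ℝ}
    (hf : f ∈ boundedMeasurable X) : act P f ∈ boundedMeasurable X := by
  obtain ⟨D, hD⟩ := h
  rw [← hD.eq_act ⟨f, hf⟩]
  exact (D ⟨f, hf⟩).2

theorem integral_eq_integral_act (h : IsRegular P) {f : X → ℝ} (hf : f ∈ boundedMeasurable X)
    (ν : FiniteMeasure X) :
    ∫ x, f x ∂(P ν : Measure X) = ∫ x, act P f x ∂(ν : Measure X) := by
  obtain ⟨D, hD⟩ := h
  rw [← hD.eq_act ⟨f, hf⟩]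
  exact hD ⟨f, hf⟩ ν

theorem act_add (h : IsMarkovOperator P) {f g : X → ℝ} (hf : f ∈ boundedMeasurable X)
    (hg : g ∈ boundedMeasurable X) (x : X) :
    act P (fun y => f y + g y) x = act P f x + act P g x := by
  have := h.isProbabilityMeasure x
  exact integral_add (integrable_of_mem_boundedMeasurable hf)
    (integrable_of_mem_boundedMeasurable hg)

theorem act_sub (h : IsMarkovOperator P) {f g : X → ℝ} (hf : f ∈ boundedMeasurable X)
    (hg : g ∈ boundedMeasurable X) (x : X) :
    act P (fun y => f y - g y) x = act P f x - act P g x := by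
  have := h.isProbabilityMeasure x
  exact integral_sub (integrable_of_mem_boundedMeasurable hf)
    (integrable_of_mem_boundedMeasurable hg)

theorem act_const_mul (P : FiniteMeasure X → FiniteMeasure X) (c : ℝ) (f : X → ℝ) (x : X) :
    act P (fun y => c * f y) x = c * act P f x :=
  integral_const_mul c f

theorem act_const (h : IsMarkovOperator P) (c : ℝ) (x : X) : act P (fun _ => c) x = c := by
  have := h.isProbabilityMeasure x
  rw [act_def]; simp

theorem act_mono (h : IsMarkovOperator P) {f g : X → ℝ} (hf : f ∈ boundedMeasurable X)
    (hg : g ∈ boundedMeasurable X) (hfg : ∀ y, f y ≤ g y) (x : X) : act P f x ≤ act P g x := by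
  have := h.isProbabilityMeasure x
  exact integral_mono (integrable_of_mem_boundedMeasurable hf)
    (integrable_of_mem_boundedMeasurable hg) hfg

theorem act_nonneg (P : FiniteMeasure X → FiniteMeasure X) {f : X → ℝ} (hf : ∀ y, 0 ≤ f y)
    (x : X) : 0 ≤ act P f x :=
  integral_nonneg hf

/-- The pointwise modulus of `P f` is controlled by `P g` when `|f| ≤ g`. -/
theorem abs_act_le_act (h : IsMarkovOperator P) {f g : X → ℝ}
    (hg : g ∈ boundedMeasurable X) (hfg : ∀ y, |f y| ≤ g y) (x : X) : |act P f x| ≤ act P g x := by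
  have := h.isProbabilityMeasure x
  exact norm_integral_le_of_norm_le (f := f) (integrable_of_mem_boundedMeasurable hg)
    (ae_of_all _ hfg)

theorem abs_act_le (h : IsMarkovOperator P) {f : X → ℝ} {C : ℝ} (hf : ∀ y, |f y| ≤ C) (x : X) :
    |act P f x| ≤ C :=
  (abs_act_le_act h (const_mem_boundedMeasurable C) hf x).trans_eq (act_const h C x)

/-- Dominated convergence for the operator `f ↦ P f`. -/
theorem tendsto_act (h : IsMarkovOperator P) {f : ℕ → X → ℝ} {g : X → ℝ} {C : ℝ} {x : X}
    (hf : ∀ n, f n ∈ boundedMeasurable X) (hC : ∀ n y, |f n y| ≤ C)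
    (hlim : ∀ᵐ y ∂(transition P x), Tendsto (fun n => f n y) atTop (𝓝 (g y))) :
    Tendsto (fun n => act P (f n) x) atTop (𝓝 (act P g x)) := by
  have := h.isProbabilityMeasure x
  exact tendsto_integral_of_dominated_convergence (fun _ => C)
    (fun n => (hf n).1.aestronglyMeasurable) (integrable_const C)
    (fun n => ae_of_all _ (hC n)) hlim

theorem continuous_act [TopologicalSpace X] (h : IsMarkovFellerOperator P) {f : X → ℝ}
    (hf : Continuous f) {C : ℝ} (hC : ∀ x, |f x| ≤ C) : Continuous (act P f) := by
  obtain ⟨g, hg⟩ := h.feller (BoundedContinuousFunction.ofNormedAddCommGroup f hf C hC)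
  have : act P f = g := funext fun x => (hg x).symm
  rw [this]
  exact g.continuous

theorem act_semigroup [TopologicalSpace X] {T : Type*} [Add T]
    {P : T → FiniteMeasure X → FiniteMeasure X} (h : IsMarkovFellerSemigroup P) (s t : T)
    {f : X → ℝ} (hf : f ∈ boundedMeasurable X) :
    act (P (s + t)) f = act (P t) (act (P s) f) := by
  funext x
  unfold act
  rw [h.semigroup s t]
  exact integral_eq_integral_act (h.markovFeller s).regular hf _

end Basic

/-! ### Ergodic measures and subharmonic functions -/

section Ergodic

variable {X : Type*} [MeasurableSpace X]

theorem act_ae_eq_of_ae_le_act {P : FiniteMeasure X → FiniteMeasure X} (h : IsRegular P)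
    {μ : FiniteMeasure X} (hμ : P μ = μ) {u : X → ℝ} (hu : u ∈ boundedMeasurable X)
    (hle : u ≤ᵐ[(μ : Measure X)] act P u) : act P u =ᵐ[(μ : Measure X)] u := by
  have hint := integral_eq_integral_act h hu μ
  rw [hμ] at hint
  exact ((integral_eq_iff_of_ae_le (integrable_of_mem_boundedMeasurable hu)
    (integrable_of_mem_boundedMeasurable (act_mem_boundedMeasurable h hu)) hle).1 hint).symm

theorem act_ae_eq_of_act_ae_le {P : FiniteMeasure X → FiniteMeasure X} (h : IsRegular P)
    {μ : FiniteMeasure X} (hμ : P μ = μ) {u : X → ℝ} (hu : u ∈ boundedMeasurable X)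
    (hle : act P u ≤ᵐ[(μ : Measure X)] u) : act P u =ᵐ[(μ : Measure X)] u := by
  have hint := integral_eq_integral_act h hu μ
  rw [hμ] at hint
  exact (integral_eq_iff_of_ae_le
    (integrable_of_mem_boundedMeasurable (act_mem_boundedMeasurable h hu))
    (integrable_of_mem_boundedMeasurable hu) hle).1 hint.symm

variable {T : Type*} {P : T → FiniteMeasure X → FiniteMeasure X} {μ : ProbabilityMeasure X}

/-- A bounded subharmonic function is almost surely at least its mean with respect to an ergodic
measure. By invariance of `μ` it is harmonic almost everywhere, and then so are the truncations
`min 1 (j * (m - g)⁺)`, which increase to the indicator of `{g < m}`. -/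
theorem IsErgodicMeasure.measure_lt_eq_zero (hP : ∀ t, IsMarkovOperator (P t))
    (hR : ∀ t, IsRegular (P t)) (hμ : IsErgodicMeasure P μ) {g : X → ℝ}
    (hg : g ∈ boundedMeasurable X) (hle : ∀ t x, g x ≤ act (P t) g x) {m : ℝ}
    (hm : m ≤ ∫ x, g x ∂(μ : Measure X)) : (μ : Measure X) {x | g x < m} = 0 := by
  set A : Set X := {x | g x < m} with hA
  have hAm : MeasurableSet A := measurableSet_lt hg.1 measurable_const
  set k : X → ℝ := fun x => m - g x with hk
  have hkb : k ∈ boundedMeasurable X := sub_mem (const_mem_boundedMeasurable m) hg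
  set kp : X → ℝ := fun x => max (k x) 0 with hkp
  have hkpb : kp ∈ boundedMeasurable X :=
    max_mem_boundedMeasurable hkb (const_mem_boundedMeasurable 0)
  let q : ℕ → X → ℝ := fun j x => min 1 ((j : ℝ) * kp x)
  have hqb : ∀ j, q j ∈ boundedMeasurable X := fun j =>
    min_mem_boundedMeasurable (const_mem_boundedMeasurable 1)
      (const_mul_mem_boundedMeasurable (j : ℝ) hkpb)
  have hq0 : ∀ j x, 0 ≤ q j x := fun j x =>
    le_min zero_le_one (mul_nonneg j.cast_nonneg (le_max_right _ _))
  have hq1 : ∀ j x, |q j x| ≤ 1 := fun j x => by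
    rw [abs_of_nonneg (hq0 j x)]; exact min_le_left _ _
  have hqlim : ∀ x, Tendsto (fun j => q j x) atTop (𝓝 (A.indicator (fun _ => (1 : ℝ)) x)) := by
    intro x
    by_cases hx : x ∈ A
    · have hpos : 0 < kp x := lt_max_of_lt_left (sub_pos.2 hx)
      rw [Set.indicator_of_mem hx]
      refine tendsto_const_nhds.congr' ?_
      have := (tendsto_natCast_atTop_atTop (R := ℝ)).atTop_mul_const hpos
      filter_upwards [this.eventually_ge_atTop 1] with j hj
      exact (min_eq_left hj).symm
    · have hz : kp x = 0 := max_eq_right (sub_nonpos.2 (not_lt.1 hx))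
      rw [Set.indicator_of_notMem hx]
      simp [q, hz]
  have hinv : ∀ t, act (P t) (A.indicator fun _ => (1 : ℝ)) =ᵐ[(μ : Measure X)]
      A.indicator fun _ => (1 : ℝ) := by
    intro t
    have h1 : act (P t) g =ᵐ[(μ : Measure X)] g :=
      act_ae_eq_of_ae_le_act (hR t) (hμ.invariant t) hg (ae_of_all _ (hle t))
    have h2 : act (P t) kp =ᵐ[(μ : Measure X)] kp := by
      refine act_ae_eq_of_ae_le_act (hR t) (hμ.invariant t) hkpb ?_
      filter_upwards [h1] with x hx
      refine max_le ?_ (act_nonneg _ (fun y => le_max_right _ _) x)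
      calc k x = act (P t) k x := by
            rw [hk, act_sub (hP t) (const_mem_boundedMeasurable m) hg, act_const (hP t), hx]
        _ ≤ _ := act_mono (hP t) hkb hkpb (fun y => le_max_left _ _) x
    have h3 : ∀ j, act (P t) (q j) =ᵐ[(μ : Measure X)] q j := by
      intro j
      refine act_ae_eq_of_act_ae_le (hR t) (hμ.invariant t) (hqb j) ?_
      filter_upwards [h2] with x hx
      refine le_min ?_ ?_
      · exact (le_abs_self _).trans (abs_act_le (hP t) (hq1 j) x)
      · rw [← hx, ← act_const_mul]
        exact act_mono (hP t) (hqb j) (const_mul_mem_boundedMeasurable (j : ℝ) hkpb)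
          (fun y => min_le_right _ _) x
    filter_upwards [ae_all_iff.2 h3] with x hx
    refine tendsto_nhds_unique (tendsto_act (hP t) hqb hq1 (ae_of_all _ hqlim)) ?_
    simp only [hx]
    exact hqlim x
  rcases hμ.zero_or_one A hAm hinv with h0 | h1
  · exact h0
  · exfalso
    have hae : ∀ᵐ x ∂(μ : Measure X), 0 < k x := by
      have : ∀ᵐ x ∂(μ : Measure X), x ∈ A := (prob_compl_eq_zero_iff hAm).2 h1
      filter_upwards [this] with x hx using sub_pos.2 hx
    have hki : Integrable k (μ : Measure X) := integrable_of_mem_boundedMeasurable hkb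
    have hpos : 0 < ∫ x, k x ∂(μ : Measure X) := by
      refine (integral_pos_iff_support_of_nonneg_ae (hae.mono fun x hx => hx.le) hki).2 ?_
      refine lt_of_lt_of_le ?_ (measure_mono (s := A) fun x hx => (sub_pos.2 hx).ne')
      rw [h1]; exact zero_lt_one
    have : ∫ x, k x ∂(μ : Measure X) = m - ∫ x, g x ∂(μ : Measure X) := by
      rw [hk, integral_sub (integrable_const m) (integrable_of_mem_boundedMeasurable hg)]
      simp
    linarith

end Ergodic

/-! ### Recurrence along the semigroup -/

section Recurrence

variable {X : Type*} [MetricSpace X] [MeasurableSpace X] [BorelSpace X]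
  {T : Type*} [AddCommSemigroup T] [LinearOrder T] [Nonempty T]
  [(atTop : Filter T).IsCountablyGenerated]
  {P : T → FiniteMeasure X → FiniteMeasure X} {μ : ProbabilityMeasure X}

/-- Under eventual continuity, from every point of the support of an ergodic measure the
values `P_t φ` come arbitrarily close to, or above, the mean of `φ` at some time. The function
`g = inf_n sup_{t ≥ τ_n} P_t φ` is subharmonic with mean at least that of `φ`, hence is almost
surely at least that mean, and eventual continuity carries this from a nearby generic point. The
inner suprema of continuous functions are lower semicontinuous, which makes `g` measurable
although the set of times may be uncountable. The hypothesis `hsub` is subtraction of times,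
stated so as to hold both for `ℕ+`, which has no zero, and for `ℝ≥0`. -/
theorem exists_lt_act_of_mem_support (hsub : ∀ s n t : T, s + n ≤ t → ∃ u, n ≤ u ∧ t = s + u)
    (hP : IsMarkovFellerSemigroup P) (hμ : IsErgodicMeasure P μ) {z : X}
    (hec : IsEventuallyContinuousAt P z) (hz : z ∈ (μ : Measure X).support) {φ : X → ℝ}
    (hφ : IsBoundedLipschitz φ) {η : ℝ} (hη : 0 < η) :
    ∃ s, ∫ x, φ x ∂(μ : Measure X) - η < act (P s) φ z := by
  obtain ⟨⟨K, hK⟩, C, hC⟩ := id hφ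
  have hM : ∀ t, IsMarkovOperator (P t) := fun t => (hP.markovFeller t).markov
  have hR : ∀ t, IsRegular (P t) := fun t => (hP.markovFeller t).regular
  have hφb : φ ∈ boundedMeasurable X := mem_boundedMeasurable_of_continuous hK.continuous hC
  obtain ⟨τ, hτm, hτ⟩ := exists_seq_monotone_tendsto_atTop_atTop T
  have hb : ∀ t x, |act (P t) φ x| ≤ C := fun t x => abs_act_le (hM t) hC x
  let G : ℕ → X → ℝ := fun n x => ⨆ t : Set.Ici (τ n), act (P t) φ x
  have hne : ∀ n, Nonempty (Set.Ici (τ n)) := fun n => ⟨⟨τ n, le_rfl⟩⟩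
  have hbdd : ∀ n x, BddAbove (Set.range fun t : Set.Ici (τ n) => act (P t) φ x) := fun n x =>
    ⟨C, by rintro _ ⟨t, rfl⟩; exact (abs_le.1 (hb t x)).2⟩
  have hleG : ∀ n t, τ n ≤ t → ∀ x, act (P t) φ x ≤ G n x := fun n t ht x =>
    le_ciSup (hbdd n x) ⟨t, ht⟩
  have hGC : ∀ n x, |G n x| ≤ C := fun n x =>
    abs_le.2 ⟨(abs_le.1 (hb (τ n) x)).1.trans (hleG n _ le_rfl x),
      ciSup_le fun t => (abs_le.1 (hb t x)).2⟩
  have hGb : ∀ n, G n ∈ boundedMeasurable X := fun n =>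
    ⟨(lowerSemicontinuous_ciSup (hbdd n) fun t =>
      (continuous_act (hP.markovFeller t) hK.continuous hC).lowerSemicontinuous).measurable,
      C, hGC n⟩
  have hGanti : ∀ x, Antitone fun n => G n x := fun x n k hnk =>
    ciSup_le fun t => hleG n t ((hτm hnk).trans t.2) x
  have hGbelow : ∀ x, BddBelow (Set.range fun n => G n x) := fun x =>
    ⟨-C, by rintro _ ⟨n, rfl⟩; exact (abs_le.1 (hGC n x)).1⟩
  let g : X → ℝ := fun x => ⨅ n, G n x
  have hlim : ∀ x, Tendsto (fun n => G n x) atTop (𝓝 (g x)) := fun x =>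
    tendsto_atTop_ciInf (hGanti x) (hGbelow x)
  have hgG : ∀ n x, g x ≤ G n x := fun n x => ciInf_le (hGbelow x) n
  have hgb : g ∈ boundedMeasurable X :=
    ⟨measurable_of_tendsto_metrizable (fun n => (hGb n).1) (tendsto_pi_nhds.2 hlim), C, fun x =>
      abs_le.2 ⟨le_ciInf fun n => (abs_le.1 (hGC n x)).1,
        (hgG 0 x).trans (abs_le.1 (hGC 0 x)).2⟩⟩
  have hsubh : ∀ s x, g x ≤ act (P s) g x := by
    intro s x
    refine ge_of_tendsto' (tendsto_act (hM s) hGb hGC (ae_of_all _ hlim)) fun n => ?_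
    obtain ⟨k, hk⟩ := (hτ.eventually_ge_atTop (s + τ n)).exists
    refine (hgG k x).trans (ciSup_le fun t => ?_)
    obtain ⟨u, hu, htu⟩ := hsub s (τ n) t (hk.trans t.2)
    rw [htu, add_comm, act_semigroup hP _ _ hφb]
    exact act_mono (hM s) (act_mem_boundedMeasurable (hR u) hφb) (hGb n) (hleG n u hu) x
  have hmean : ∫ x, φ x ∂(μ : Measure X) ≤ ∫ x, g x ∂(μ : Measure X) := by
    have hl : Tendsto (fun n => ∫ x, G n x ∂(μ : Measure X)) atTop
        (𝓝 (∫ x, g x ∂(μ : Measure X))) :=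
      tendsto_integral_of_dominated_convergence (fun _ => C)
        (fun n => (hGb n).1.aestronglyMeasurable) (integrable_const C)
        (fun n => ae_of_all _ (hGC n)) (ae_of_all _ hlim)
    refine ge_of_tendsto' hl fun n => ?_
    have h1 := integral_eq_integral_act (hR (τ n)) hφb μ.toFiniteMeasure
    rw [hμ.invariant] at h1
    exact h1.trans_le (integral_mono
      (integrable_of_mem_boundedMeasurable (act_mem_boundedMeasurable (hR _) hφb))
      (integrable_of_mem_boundedMeasurable (hGb n)) (hleG n _ le_rfl))
  have hnull := hμ.measure_lt_eq_zero hM hR hgb hsubh hmean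
  obtain ⟨δ, hδ, hδz⟩ := hec φ hφ (η / 2) (half_pos hη)
  obtain ⟨y, hy, hyg⟩ : ∃ y ∈ Metric.ball z δ, ∫ x, φ x ∂(μ : Measure X) ≤ g y := by
    by_contra! hcon
    have hpos := (Measure.mem_support_iff_forall z).1 hz _ (Metric.ball_mem_nhds z hδ)
    exact hpos.ne' (measure_mono_null hcon hnull)
  obtain ⟨t₀, ht₀⟩ := hδz y hy
  obtain ⟨n, hn⟩ := (hτ.eventually_ge_atTop t₀).exists
  have hlt : ∫ x, φ x ∂(μ : Measure X) - η / 2 < G n y :=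
    lt_of_lt_of_le (by linarith) (hgG n y)
  obtain ⟨t, ht⟩ := exists_lt_of_lt_ciSup hlt
  refine ⟨t, ?_⟩
  have := (abs_lt.1 (ht₀ t (hn.trans t.2))).2
  linarith

/-- The support of an invariant measure is absorbing for a Feller operator. -/
theorem ae_mem_support_of_mem_support [SecondCountableTopology X]
    {P : FiniteMeasure X → FiniteMeasure X} (hP : IsMarkovFellerOperator P)
    (hμ : P μ.toFiniteMeasure = μ.toFiniteMeasure) {z : X} (hz : z ∈ (μ : Measure X).support) :
    ∀ᵐ x ∂(transition P z), x ∈ (μ : Measure X).support := by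
  set S := (μ : Measure X).support
  let φ : X → ℝ := fun x => min 1 (Metric.infDist x S)
  have hφc : Continuous φ := continuous_const.min (Metric.continuous_infDist_pt S)
  have hφ0 : ∀ x, 0 ≤ φ x := fun x => le_min zero_le_one Metric.infDist_nonneg
  have hφ1 : ∀ x, |φ x| ≤ 1 := fun x => by
    rw [abs_of_nonneg (hφ0 x)]; exact min_le_left _ _
  have hφb := mem_boundedMeasurable_of_continuous hφc hφ1
  have hφS : ∀ x, φ x = 0 → x ∈ S := by
    intro x hx
    have hcl : closure S = S := Measure.isClosed_support.closure_eq
    rw [← hcl, Metric.mem_closure_iff_infDist_zero ⟨z, hz⟩]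
    rcases min_choice 1 (Metric.infDist x S) with h | h
    · exact absurd (h.symm.trans hx) one_ne_zero
    · exact h.symm.trans hx
  have hmean : ∫ x, act P φ x ∂(μ : Measure X) = 0 := by
    have h1 := integral_eq_integral_act hP.regular hφb μ.toFiniteMeasure
    rw [hμ] at h1
    refine h1.symm.trans (integral_eq_zero_of_ae ?_)
    filter_upwards [(Measure.support_mem_ae : S ∈ ae (μ : Measure X))] with x hx
    have h0 : Metric.infDist x S = 0 := Metric.infDist_zero_of_mem hx
    exact (congrArg (min 1) h0).trans (min_eq_right zero_le_one)
  have hactc : Continuous (act P φ) := continuous_act hP hφc hφ1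
  have hae := (integral_eq_zero_iff_of_nonneg (fun x => act_nonneg P hφ0 x)
    (integrable_of_mem_boundedMeasurable (act_mem_boundedMeasurable hP.regular hφb))).1 hmean
  have hz0 : act P φ z = 0 := by
    by_contra hne
    exact ((Measure.mem_support_iff_forall z).1 hz _
      ((isOpen_ne.preimage hactc).mem_nhds hne)).ne' hae
  have := hP.markov.isProbabilityMeasure z
  have hae' := (integral_eq_zero_iff_of_nonneg hφ0 (integrable_of_mem_boundedMeasurable hφb)).1 hz0
  filter_upwards [hae'] with x hx using hφS x hx

end Recurrence

/-! ### Asymptotically almost constant functions -/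

section Oscillation

variable {X : Type*} [MetricSpace X]

theorem exists_bump (y : X) {δ : ℝ} (hδ : 0 < δ) :
    ∃ u : X → ℝ, (∃ K : ℝ≥0, LipschitzWith K u) ∧ (∀ x, 0 ≤ u x) ∧ (∀ x, u x ≤ 1) ∧
      (∀ x ∈ Metric.ball y (δ / 2), u x = 1) ∧ ∀ x, x ∉ Metric.ball y δ → u x = 0 := by
  refine ⟨fun x => (thickenedIndicator (half_pos hδ) (Metric.ball y (δ / 2)) x : ℝ),
    ⟨_, NNReal.isometry_coe.lipschitz.comp (lipschitzWith_thickenedIndicator (half_pos hδ) _)⟩,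
    fun x => NNReal.coe_nonneg _, fun x => ?_, fun x hx => ?_, fun x hx => ?_⟩
  · exact_mod_cast thickenedIndicator_le_one (half_pos hδ) _ x
  · simp [thickenedIndicator_one (half_pos hδ) _ hx]
  · have : x ∉ Metric.thickening (δ / 2) (Metric.ball y (δ / 2)) := by
      intro h
      obtain ⟨w, hw, hxw⟩ := Metric.mem_thickening_iff.1 h
      refine hx (Metric.mem_ball.2 ?_)
      have := dist_triangle x w y
      have := Metric.mem_ball.1 hw
      linarith
    simp [thickenedIndicator_zero (half_pos hδ) _ this]

variable [MeasurableSpace X] {T : Type*} [LinearOrder T]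

/-- On the set `V`, each function `P_t f` with `t ≥ n` is within `r` of some constant, which may
depend on `t`. -/
def IsNearlyConstantOn (P : T → FiniteMeasure X → FiniteMeasure X) (f : X → ℝ) (r : ℝ)
    (V : Set X) (n : T) : Prop :=
  ∀ t, n ≤ t → ∃ c : ℝ, ∀ x ∈ V, |act (P t) f x - c| ≤ r

/-- Near `z` and for all large times, the functions `P_t f` are within `r` of constants. The infimum
of such `r` is the asymptotic oscillation of `P_t f` at `z`, measured by radius and not by
diameter: with diameters a convex combination of local bounds would lose a factor two. -/
def IsNearlyConstantAt (P : T → FiniteMeasure X → FiniteMeasure X) (f : X → ℝ) (r : ℝ)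
    (z : X) : Prop :=
  ∃ V ∈ 𝓝 z, ∃ n : T, IsNearlyConstantOn P f r V n

/-- The contribution of the weight `χ` to the asymptotic oscillation at `z` is at most `β`: near
`z` and for all large times `t`, the functions `P_s (χ * P_t f)` are within `β`, up to an
arbitrarily small error, of constants. -/
def HasWeightedBoundAt (P : T → FiniteMeasure X → FiniteMeasure X) (f : X → ℝ) (s : T) (z : X)
    (χ : X → ℝ) (β : ℝ) : Prop :=
  ∀ η > 0, ∃ V ∈ 𝓝 z, ∃ n : T, ∀ t, n ≤ t → ∃ c : ℝ, ∀ x ∈ V,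
    |act (P s) (fun y => χ y * act (P t) f y) x - c| ≤ β + η

variable {P : T → FiniteMeasure X → FiniteMeasure X} {f : X → ℝ}

theorem IsNearlyConstantAt.mono {r r' : ℝ} {z : X} (h : IsNearlyConstantAt P f r z)
    (hr : r ≤ r') : IsNearlyConstantAt P f r' z := by
  obtain ⟨V, hV, n, hn⟩ := h
  exact ⟨V, hV, n, fun t ht => (hn t ht).imp fun c hc x hx => (hc x hx).trans hr⟩

theorem isOpen_setOf_isNearlyConstantAt (r : ℝ) : IsOpen {z | IsNearlyConstantAt P f r z} := by
  refine isOpen_iff_mem_nhds.2 ?_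
  rintro z ⟨V, hV, n, hn⟩
  filter_upwards [eventually_mem_nhds_iff.2 hV] with y hy using ⟨V, hy, n, hn⟩

theorem HasWeightedBoundAt.mono {s : T} {z : X} {χ : X → ℝ} {β β' : ℝ}
    (h : HasWeightedBoundAt P f s z χ β) (hβ : β ≤ β') : HasWeightedBoundAt P f s z χ β' := by
  intro η hη
  obtain ⟨V, hV, n, hn⟩ := h η hη
  exact ⟨V, hV, n, fun t ht => (hn t ht).imp fun c hc x hx => (hc x hx).trans (by linarith)⟩

theorem HasWeightedBoundAt.of_forall_pos {s : T} {z : X} {χ : X → ℝ} {β : ℝ}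
    (h : ∀ η > 0, HasWeightedBoundAt P f s z χ (β + η)) : HasWeightedBoundAt P f s z χ β := by
  intro η hη
  obtain ⟨V, hV, n, hn⟩ := h (η / 2) (half_pos hη) (η / 2) (half_pos hη)
  exact ⟨V, hV, n, fun t ht => (hn t ht).imp fun c hc x hx => (hc x hx).trans (by linarith)⟩

theorem HasWeightedBoundAt.add (hP : ∀ t, IsMarkovOperator (P t)) (hR : ∀ t, IsRegular (P t))
    (hf : f ∈ boundedMeasurable X) {s : T} {z : X} {χ₁ χ₂ : X → ℝ} {β₁ β₂ : ℝ}
    (hχ₁ : χ₁ ∈ boundedMeasurable X) (hχ₂ : χ₂ ∈ boundedMeasurable X)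
    (h₁ : HasWeightedBoundAt P f s z χ₁ β₁) (h₂ : HasWeightedBoundAt P f s z χ₂ β₂) :
    HasWeightedBoundAt P f s z (fun x => χ₁ x + χ₂ x) (β₁ + β₂) := by
  intro η hη
  obtain ⟨V₁, hV₁, n₁, hn₁⟩ := h₁ (η / 2) (half_pos hη)
  obtain ⟨V₂, hV₂, n₂, hn₂⟩ := h₂ (η / 2) (half_pos hη)
  refine ⟨V₁ ∩ V₂, inter_mem hV₁ hV₂, max n₁ n₂, fun t ht => ?_⟩
  obtain ⟨c₁, hc₁⟩ := hn₁ t ((le_max_left _ _).trans ht)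
  obtain ⟨c₂, hc₂⟩ := hn₂ t ((le_max_right _ _).trans ht)
  refine ⟨c₁ + c₂, fun x hx => ?_⟩
  have hft := act_mem_boundedMeasurable (hR t) hf
  have hsum := act_add (hP s) (mul_mem_boundedMeasurable hχ₁ hft)
    (mul_mem_boundedMeasurable hχ₂ hft) x
  simp only [add_mul]
  rw [hsum, add_sub_add_comm]
  refine (abs_add_le _ _).trans ?_
  have := hc₁ x hx.1
  have := hc₂ x hx.2
  linarith

theorem exists_bump_cover_isNearlyConstantAt [Nonempty T] [SecondCountableTopology X]
    (P : T → FiniteMeasure X → FiniteMeasure X) (f : X → ℝ) (r : ℝ) :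
    ∃ u : ℕ → X → ℝ, (∀ k, Continuous (u k)) ∧ (∀ k x, 0 ≤ u k x) ∧ (∀ k x, u k x ≤ 1) ∧
      (∀ k, ∃ V n, IsNearlyConstantOn P f r V n ∧ ∀ x, x ∉ V → u k x = 0) ∧
      ∀ x, IsNearlyConstantAt P f r x → ∃ k, u k x = 1 := by
  set O : Set X := {x | IsNearlyConstantAt P f r x} with hO
  have hball : ∀ x : X, ∃ δ > 0, x ∈ O → ∃ n, IsNearlyConstantOn P f r (Metric.ball x δ) n := by
    intro x
    by_cases hx : x ∈ O
    · obtain ⟨V, hV, n, hn⟩ := id hx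
      obtain ⟨δ, hδ, hδV⟩ := Metric.mem_nhds_iff.1 hV
      exact ⟨δ, hδ, fun _ => ⟨n, fun t ht =>
        (hn t ht).imp fun c hc y hy => hc y (hδV hy)⟩⟩
    · exact ⟨1, one_pos, fun h => absurd h hx⟩
  choose δ hδ hn using hball
  obtain ⟨t, htO, htc, hcov⟩ := TopologicalSpace.countable_cover_nhdsWithin (s := O)
    (f := fun x => Metric.ball x (δ x / 2))
    (fun x _ => mem_nhdsWithin_of_mem_nhds (Metric.ball_mem_nhds x (half_pos (hδ x))))
  rcases t.eq_empty_or_nonempty with rfl | hne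
  · refine ⟨fun _ _ => 0, fun _ => continuous_const, fun _ _ => le_rfl, fun _ _ => zero_le_one,
      fun _ => ⟨∅, Classical.arbitrary T, fun _ _ => ⟨0, by simp⟩, fun _ _ => rfl⟩,
      fun x hx => ?_⟩
    simpa using hcov hx
  · obtain ⟨e, rfl⟩ := htc.exists_eq_range hne
    choose u hK h0 h1 hin hout using fun k => exists_bump (e k) (hδ (e k))
    refine ⟨u, fun k => (hK k).choose_spec.continuous, h0, h1, fun k => ?_, fun x hx => ?_⟩
    · obtain ⟨n, hnk⟩ := hn (e k) (htO ⟨k, rfl⟩)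
      exact ⟨_, n, hnk, hout k⟩
    · obtain ⟨_, ⟨k, rfl⟩, hk⟩ := Set.mem_iUnion₂.1 (hcov hx)
      exact ⟨k, hin k x hk⟩

variable [BorelSpace X]

/-- A weight supported where `P_t f` is nearly constant contributes in proportion to its mass
seen from `z`. -/
theorem HasWeightedBoundAt.of_isNearlyConstantOn (hP : ∀ t, IsMarkovFellerOperator (P t))
    (hf : f ∈ boundedMeasurable X) {r : ℝ} (hr : 0 ≤ r) {V : Set X} {n : T}
    (hV : IsNearlyConstantOn P f r V n) (s : T) (z : X) {χ : X → ℝ} (hχ : Continuous χ)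
    (h0 : ∀ x, 0 ≤ χ x) (h1 : ∀ x, χ x ≤ 1) (hsupp : ∀ x, x ∉ V → χ x = 0) :
    HasWeightedBoundAt P f s z χ (r * act (P s) χ z) := by
  intro η hη
  obtain ⟨C, hC⟩ := hf.2
  have hC0 : 0 ≤ C := (abs_nonneg _).trans (hC z)
  have hM := fun t => (hP t).markov
  have habs := abs_le_one_of_mem_unit h0 h1
  have hχb := mem_boundedMeasurable_of_continuous hχ habs
  have hcont : Continuous (act (P s) χ) := continuous_act (hP s) hχ habs
  set p := act (P s) χ z
  have hev : ∀ᶠ x in 𝓝 z, (C + r) * |act (P s) χ x - p| + r * act (P s) χ x < r * p + η := by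
    have hc : Continuous fun x => (C + r) * |act (P s) χ x - p| + r * act (P s) χ x := by fun_prop
    refine hc.continuousAt.eventually_lt continuousAt_const ?_
    simp only [p, sub_self, abs_zero, mul_zero, zero_add]
    linarith
  refine ⟨_, hev, n, fun t ht => ?_⟩
  have hb : ∀ x, |act (P t) f x| ≤ C := abs_act_le (hM t) hC
  have hft := act_mem_boundedMeasurable (hP t).regular hf
  -- The approximating constants are bounded uniformly in `t`.
  obtain ⟨c, hcC, hc⟩ : ∃ c : ℝ, |c| ≤ C + r ∧ ∀ x ∈ V, |act (P t) f x - c| ≤ r := by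
    rcases V.eq_empty_or_nonempty with rfl | ⟨v, hv⟩
    · exact ⟨0, by rw [abs_zero]; linarith, by simp⟩
    · obtain ⟨c, hc⟩ := hV t ht
      refine ⟨c, ?_, hc⟩
      have h2 := abs_le.1 (hc v hv)
      have h3 := abs_le.1 (hb v)
      exact abs_le.2 ⟨by linarith, by linarith⟩
  refine ⟨c * p, fun x hx => ?_⟩
  have hsplit : act (P s) (fun y => χ y * act (P t) f y) x - c * p
      = act (P s) (fun y => χ y * act (P t) f y - c * χ y) x + c * (act (P s) χ x - p) := by
    rw [act_sub (hM s) (mul_mem_boundedMeasurable hχb hft)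
      (const_mul_mem_boundedMeasurable c hχb), act_const_mul]
    ring
  have hmain : |act (P s) (fun y => χ y * act (P t) f y - c * χ y) x| ≤ r * act (P s) χ x := by
    rw [← act_const_mul]
    refine abs_act_le_act (hM s) (const_mul_mem_boundedMeasurable r hχb) (fun y => ?_) x
    by_cases hy : y ∈ V
    · have : χ y * act (P t) f y - c * χ y = (act (P t) f y - c) * χ y := by ring
      rw [this, abs_mul, abs_of_nonneg (h0 y)]
      exact mul_le_mul_of_nonneg_right (hc y hy) (h0 y)
    · simp [hsupp y hy]
  have herr : |c * (act (P s) χ x - p)| ≤ (C + r) * |act (P s) χ x - p| := by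
    rw [abs_mul]
    exact mul_le_mul_of_nonneg_right hcC (abs_nonneg _)
  rw [hsplit]
  refine (abs_add_le _ _).trans ?_
  have hx' : (C + r) * |act (P s) χ x - p| + r * act (P s) χ x < r * p + η := hx
  linarith

/-- Localization of the asymptotic oscillation: if `P_t f` is nearly constant with radius `r` at
almost every point that the weight `χ` charges and that is reached from `z` at time `s`, the
contribution of `χ` at `z` is `r` times its mass. Countably many bump functions split off all
of `χ` up to a remainder of small mass, for which the bound `sup |f|` is enough. -/
theorem HasWeightedBoundAt.of_ae_isNearlyConstantAt [Nonempty T] [SecondCountableTopology X]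
    (hP : ∀ t, IsMarkovFellerOperator (P t)) (hf : f ∈ boundedMeasurable X) {r : ℝ} (hr : 0 ≤ r)
    {s : T} {z : X} {χ : X → ℝ} (hχ : Continuous χ) (h0 : ∀ x, 0 ≤ χ x) (h1 : ∀ x, χ x ≤ 1)
    (hae : ∀ᵐ x ∂(transition (P s) z), χ x ≠ 0 → IsNearlyConstantAt P f r x) :
    HasWeightedBoundAt P f s z χ (r * act (P s) χ z) := by
  obtain ⟨C, hC⟩ := hf.2
  have hC0 : 0 ≤ C := (abs_nonneg _).trans (hC z)
  have hM := fun t => (hP t).markov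
  have hR := fun t => (hP t).regular
  obtain ⟨u, huc, hu0, hu1, huV, hu⟩ := exists_bump_cover_isNearlyConstantAt P f r
  let ψ : ℕ → X → ℝ := fun k x => χ x * ∏ i ∈ Finset.range k, (1 - u i x)
  have hψc : ∀ k, Continuous (ψ k) := fun k =>
    hχ.mul (continuous_finsetProd _ fun i _ => continuous_const.sub (huc i))
  have hprod0 : ∀ k x, 0 ≤ ∏ i ∈ Finset.range k, (1 - u i x) := fun k x =>
    Finset.prod_nonneg fun i _ => sub_nonneg.2 (hu1 i x)
  have hprod1 : ∀ k x, ∏ i ∈ Finset.range k, (1 - u i x) ≤ 1 := fun k x =>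
    Finset.prod_le_one (fun i _ => sub_nonneg.2 (hu1 i x)) fun i _ => by
      linarith [hu0 i x]
  have hψ0 : ∀ k x, 0 ≤ ψ k x := fun k x => mul_nonneg (h0 x) (hprod0 k x)
  have hψχ : ∀ k x, ψ k x ≤ χ x := fun k x => mul_le_of_le_one_right (h0 x) (hprod1 k x)
  have hψ1 : ∀ k x, ψ k x ≤ 1 := fun k x => (hψχ k x).trans (h1 x)
  have hψabs : ∀ k x, |ψ k x| ≤ 1 := fun k => abs_le_one_of_mem_unit (hψ0 k) (hψ1 k)
  have hψb : ∀ k, ψ k ∈ boundedMeasurable X := fun k =>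
    mem_boundedMeasurable_of_continuous (hψc k) (hψabs k)
  have hχb : χ ∈ boundedMeasurable X :=
    mem_boundedMeasurable_of_continuous hχ (abs_le_one_of_mem_unit h0 h1)
  have hψu0 : ∀ k x, 0 ≤ ψ k x * u k x := fun k x => mul_nonneg (hψ0 k x) (hu0 k x)
  have hψu1 : ∀ k x, ψ k x * u k x ≤ 1 := fun k x => mul_le_one₀ (hψ1 k x) (hu0 k x) (hu1 k x)
  have hψub : ∀ k, (fun x => ψ k x * u k x) ∈ boundedMeasurable X := fun k =>
    mem_boundedMeasurable_of_continuous ((hψc k).mul (huc k))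
      (abs_le_one_of_mem_unit (hψu0 k) (hψu1 k))
  have hdiffb : ∀ k, (fun x => χ x - ψ k x) ∈ boundedMeasurable X := fun k =>
    sub_mem hχb (hψb k)
  have hind : ∀ k, HasWeightedBoundAt P f s z (fun x => χ x - ψ k x)
      (r * act (P s) (fun x => χ x - ψ k x) z) := by
    intro k
    induction k with
    | zero =>
      have : (fun x => χ x - ψ 0 x) = fun _ => 0 := by
        funext x; simp [ψ]
      rw [this]
      exact HasWeightedBoundAt.of_isNearlyConstantOn hP hf hr (V := ∅)
        (n := Classical.arbitrary T) (fun _ _ => ⟨0, by simp⟩) s z continuous_const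
        (fun _ => le_rfl) (fun _ => zero_le_one) fun _ _ => rfl
    | succ k ih =>
      have hsplit : (fun x => χ x - ψ (k + 1) x)
          = fun x => (χ x - ψ k x) + ψ k x * u k x := by
        funext x
        simp only [ψ, Finset.prod_range_succ]
        ring
      obtain ⟨V, n, hVn, hout⟩ := huV k
      rw [hsplit, act_add (hM s) (hdiffb k) (hψub k), mul_add]
      refine ih.add hM hR hf (hdiffb k) (hψub k) ?_
      exact HasWeightedBoundAt.of_isNearlyConstantOn hP hf hr hVn s z ((hψc k).mul (huc k))
        (hψu0 k) (hψu1 k) fun x hx => by rw [hout x hx, mul_zero]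
  have hlim : Tendsto (fun k => act (P s) (ψ k) z) atTop (𝓝 (act (P s) (fun _ => 0) z)) := by
    refine tendsto_act (hM s) hψb hψabs ?_
    filter_upwards [hae] with x hx
    by_cases hχx : χ x = 0
    · simp [ψ, hχx]
    · obtain ⟨k, hk⟩ := hu x (hx hχx)
      refine tendsto_const_nhds.congr' ?_
      filter_upwards [eventually_gt_atTop k] with j hj
      have : ∏ i ∈ Finset.range j, (1 - u i x) = 0 :=
        Finset.prod_eq_zero (Finset.mem_range.2 hj) (by rw [hk, sub_self])
      simp [ψ, this]
  rw [act_const (hM s)] at hlim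
  have hlim' := hlim.const_mul C
  rw [mul_zero] at hlim'
  refine HasWeightedBoundAt.of_forall_pos fun η hη => ?_
  obtain ⟨k, hk⟩ := (hlim'.eventually_lt_const hη).exists
  have hrest : HasWeightedBoundAt P f s z (ψ k) (C * act (P s) (ψ k) z) :=
    HasWeightedBoundAt.of_isNearlyConstantOn hP hf hC0 (V := Set.univ)
      (n := Classical.arbitrary T)
      (fun t _ => ⟨0, fun x _ => by rw [sub_zero]; exact abs_act_le (hM t) hC x⟩) s z (hψc k)
      (hψ0 k) (hψ1 k) fun x hx => absurd (Set.mem_univ x) hx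
  have hsum := (hind k).add hM hR hf (hdiffb k) (hψb k) hrest
  simp only [sub_add_cancel] at hsum
  refine hsum.mono (add_le_add (mul_le_mul_of_nonneg_left ?_ hr) hk.le)
  exact act_mono (hM s) (hdiffb k) hχb (fun y => sub_le_self _ (hψ0 k y)) z

end Oscillation

/-! ### From eventual continuity to the e-property -/

section EProperty

variable {X : Type*} [MetricSpace X] [MeasurableSpace X] {T : Type*}

section Baire

variable [LinearOrder T] [Nonempty T] [(atTop : Filter T).IsCountablyGenerated]

/-- By the Baire category theorem, eventual continuity at one point `z` of an open set makes `P_t f`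
nearly constant near some, possibly different, point of that set. -/
theorem exists_isNearlyConstantAt [CompleteSpace X] {P : T → FiniteMeasure X → FiniteMeasure X}
    (hP : ∀ t, IsMarkovFellerOperator (P t)) {z : X} (hec : IsEventuallyContinuousAt P z)
    {f : X → ℝ} (hf : IsBoundedLipschitz f) {U : Set X} (hU : U ∈ 𝓝 z) {ε : ℝ} (hε : 0 < ε) :
    ∃ x ∈ U, IsNearlyConstantAt P f ε x := by
  obtain ⟨⟨K, hK⟩, C, hC⟩ := id hf
  obtain ⟨τ, -, hτ⟩ := exists_seq_monotone_tendsto_atTop_atTop T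
  obtain ⟨δ, hδ, hδz⟩ := hec f hf ε hε
  obtain ⟨ρ, hρ, hρU⟩ := Metric.mem_nhds_iff.1 hU
  set B := Metric.ball z (min δ ρ) with hB
  let F : ℕ → Set X := fun n =>
    Bᶜ ∪ {x | ∀ t, τ n ≤ t → |act (P t) f x - act (P t) f z| ≤ ε}
  have hclosed : ∀ n, IsClosed (F n) := by
    intro n
    refine Metric.isOpen_ball.isClosed_compl.union ?_
    simp only [Set.ofPred_forall]
    refine isClosed_iInter fun t => isClosed_iInter fun _ => ?_
    have hc : Continuous (act (P t) f) := continuous_act (hP t) hK.continuous hC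
    exact isClosed_le (by fun_prop) continuous_const
  have hcover : ⋃ n, F n = Set.univ := by
    refine Set.eq_univ_of_forall fun x => ?_
    by_cases hx : x ∈ B
    · obtain ⟨t₀, ht₀⟩ := hδz x (Metric.ball_subset_ball (min_le_left _ _) hx)
      obtain ⟨n, hn⟩ := (hτ.eventually_ge_atTop t₀).exists
      exact Set.mem_iUnion.2 ⟨n, Or.inr fun t ht => (ht₀ t (hn.trans ht)).le⟩
    · exact Set.mem_iUnion.2 ⟨0, Or.inl hx⟩
  obtain ⟨x, hxB, hx⟩ := (dense_iUnion_interior_of_closed hclosed hcover).inter_open_nonempty B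
    Metric.isOpen_ball ⟨z, Metric.mem_ball_self (lt_min hδ hρ)⟩
  obtain ⟨n, hn⟩ := Set.mem_iUnion.1 hx
  refine ⟨x, hρU (Metric.ball_subset_ball (min_le_right _ _) hxB), B ∩ interior (F n),
    inter_mem (Metric.isOpen_ball.mem_nhds hxB) (isOpen_interior.mem_nhds hn), τ n,
    fun t ht => ⟨act (P t) f z, fun y hy => ?_⟩⟩
  rcases interior_subset hy.2 with h | h
  · exact absurd hy.1 h
  · exact h t ht

end Baire

variable [BorelSpace X] [AddCommSemigroup T] [LinearOrder T] [Nonempty T]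
  {P : T → FiniteMeasure X → FiniteMeasure X}

/-- Subharmonicity of the asymptotic oscillation, for two levels: suppose that `P_t f` is nearly
constant with radius `r` near almost every point reached from `z` at time `s`, and with radius `ε`
near the points that `φ` charges. Then it is nearly constant near `z`, with the average of the two
radii for the weights `1 - P_s φ (z)` and `P_s φ (z)`, up to an arbitrarily small error. -/
theorem IsNearlyConstantAt.of_act [SecondCountableTopology X]
    (hsub : ∀ s n t : T, s + n ≤ t → ∃ u, n ≤ u ∧ t = s + u)
    (hP : IsMarkovFellerSemigroup P) {f : X → ℝ} (hf : f ∈ boundedMeasurable X)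
    {s : T} {z : X} {φ : X → ℝ} (hφ : Continuous φ) (h0 : ∀ x, 0 ≤ φ x) (h1 : ∀ x, φ x ≤ 1)
    {ε r : ℝ} (hε : 0 ≤ ε) (hr : 0 ≤ r)
    (hφε : ∀ x, φ x ≠ 0 → IsNearlyConstantAt P f ε x)
    (hrae : ∀ᵐ x ∂(transition (P s) z), IsNearlyConstantAt P f r x) {η : ℝ} (hη : 0 < η) :
    IsNearlyConstantAt P f (ε * act (P s) φ z + r * (1 - act (P s) φ z) + η) z := by
  have hM := fun t => (hP.markovFeller t).markov
  have hR := fun t => (hP.markovFeller t).regular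
  have h0' : ∀ x, 0 ≤ 1 - φ x := fun x => sub_nonneg.2 (h1 x)
  have h1' : ∀ x, 1 - φ x ≤ 1 := fun x => sub_le_self _ (h0 x)
  have hφb : φ ∈ boundedMeasurable X :=
    mem_boundedMeasurable_of_continuous hφ (abs_le_one_of_mem_unit h0 h1)
  have hφb' : (fun x => 1 - φ x) ∈ boundedMeasurable X :=
    sub_mem (const_mem_boundedMeasurable 1) hφb
  have hb1 : HasWeightedBoundAt P f s z φ (ε * act (P s) φ z) :=
    HasWeightedBoundAt.of_ae_isNearlyConstantAt hP.markovFeller hf hε hφ h0 h1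
      (ae_of_all _ hφε)
  have hb2 : HasWeightedBoundAt P f s z (fun x => 1 - φ x)
      (r * act (P s) (fun x => 1 - φ x) z) :=
    HasWeightedBoundAt.of_ae_isNearlyConstantAt hP.markovFeller hf hr (continuous_const.sub hφ)
      h0' h1' (hrae.mono fun x hx _ => hx)
  rw [act_sub (hM s) (const_mem_boundedMeasurable 1) hφb, act_const (hM s)] at hb2
  obtain ⟨V, hV, n, hn⟩ := hb1.add hM hR hf hφb hφb' hb2 η hη
  refine ⟨V, hV, s + n, fun t ht => ?_⟩
  obtain ⟨u, hu, rfl⟩ := hsub s n t ht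
  have hact : act (P (s + u)) f = act (P s) (act (P u) f) := by
    rw [add_comm, act_semigroup hP u s hf]
  rw [hact]
  simpa using hn u hu

variable [(atTop : Filter T).IsCountablyGenerated] {μ : ProbabilityMeasure X}

/-- The asymptotic oscillation of `P_t f` vanishes on the support of an ergodic measure as soon as
it takes arbitrarily small values there. Let `M` be its supremum over the support, and let `φ` be
a bump where it is at most `ε`. Every point of the support charges `φ` at some time with a mass
that exceeds some `α > 0`, which gives `M ≤ α ε + (1 - α) M`, that is, `M ≤ ε`. -/
theorem isNearlyConstantAt_of_mem_support [SecondCountableTopology X]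
    (hsub : ∀ s n t : T, s + n ≤ t → ∃ u, n ≤ u ∧ t = s + u)
    (hP : IsMarkovFellerSemigroup P) (hec : ∀ z, IsEventuallyContinuousAt P z)
    (hμ : IsErgodicMeasure P μ) {f : X → ℝ} (hf : f ∈ boundedMeasurable X)
    (hsmall : ∀ ε > 0, ∃ x ∈ (μ : Measure X).support, IsNearlyConstantAt P f ε x)
    {z : X} (hz : z ∈ (μ : Measure X).support) {ε : ℝ} (hε : 0 < ε) :
    IsNearlyConstantAt P f ε z := by
  obtain ⟨C, hC⟩ := hf.2
  have hM := fun t => (hP.markovFeller t).markov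
  let S : Set ℝ := {r | 0 ≤ r ∧ ∀ y ∈ (μ : Measure X).support, IsNearlyConstantAt P f r y}
  have hSC : C ∈ S := ⟨(abs_nonneg _).trans (hC z), fun y _ => ⟨Set.univ, univ_mem,
    Classical.arbitrary T, fun t _ => ⟨0, fun x _ => by
      rw [sub_zero]; exact abs_act_le (hM t) hC x⟩⟩⟩
  have hSbdd : BddBelow S := ⟨0, fun r hr => hr.1⟩
  suffices h : sInf S < ε by
    obtain ⟨r, hr, hrε⟩ := exists_lt_of_csInf_lt ⟨C, hSC⟩ h
    exact (hr.2 z hz).mono hrε.le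
  refine lt_of_le_of_lt ?_ (half_lt_self hε)
  set e := ε / 2 with he
  have he0 : 0 < e := half_pos hε
  by_contra! hlt
  obtain ⟨x₀, hx₀, hnc⟩ := hsmall e he0
  obtain ⟨δ, hδ, hδO⟩ := Metric.isOpen_iff.1 (isOpen_setOf_isNearlyConstantAt (P := P) (f := f) e)
    x₀ hnc
  obtain ⟨φ, ⟨K, hK⟩, h0, h1, hin, hout⟩ := exists_bump x₀ hδ
  have hφe : ∀ x, φ x ≠ 0 → IsNearlyConstantAt P f e x := fun x hx =>
    hδO (by by_contra h; exact hx (hout x h))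
  have hφb : φ ∈ boundedMeasurable X :=
    mem_boundedMeasurable_of_continuous hK.continuous (abs_le_one_of_mem_unit h0 h1)
  have hφpos : 0 < ∫ x, φ x ∂(μ : Measure X) := by
    rw [integral_pos_iff_support_of_nonneg h0 (integrable_of_mem_boundedMeasurable hφb)]
    refine lt_of_lt_of_le ((Measure.mem_support_iff_forall x₀).1 hx₀ _
      (Metric.ball_mem_nhds x₀ (half_pos hδ))) (measure_mono fun x hx => ?_)
    rw [Function.mem_support, hin x hx]
    exact one_ne_zero
  set α := (∫ x, φ x ∂(μ : Measure X)) / 2 with hα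
  have hα0 : 0 < α := half_pos hφpos
  set η := α * (sInf S - e) / 3 with hη
  have hη0 : 0 < η := by have := mul_pos hα0 (sub_pos.2 hlt); positivity
  obtain ⟨r, hr, hrlt⟩ := exists_lt_of_csInf_lt ⟨C, hSC⟩ (lt_add_of_pos_right (sInf S) hη0)
  have hSr : sInf S ≤ r := csInf_le hSbdd hr
  have hvisit : ∀ y ∈ (μ : Measure X).support, ∃ s, α < act (P s) φ y := by
    intro y hy
    obtain ⟨s, hs⟩ := exists_lt_act_of_mem_support hsub hP hμ (hec y) hy
      ⟨⟨K, hK⟩, 1, abs_le_one_of_mem_unit h0 h1⟩ hα0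
    exact ⟨s, by rw [hα] at hs ⊢; linarith⟩
  have hα1 : α ≤ 1 := by
    obtain ⟨s, hs⟩ := hvisit z hz
    exact hs.le.trans ((le_abs_self _).trans
      (abs_act_le (hM s) (abs_le_one_of_mem_unit h0 h1) z))
  have hmem : r - α * (r - e) + η ∈ S := by
    refine ⟨?_, fun y hy => ?_⟩
    · have : 0 ≤ (1 - α) * r := mul_nonneg (sub_nonneg.2 hα1) hr.1
      have : 0 < α * e := mul_pos hα0 he0
      linarith
    · obtain ⟨s, hs⟩ := hvisit y hy
      have hae := ae_mem_support_of_mem_support (hP.markovFeller s) (hμ.invariant s) hy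
      refine (IsNearlyConstantAt.of_act hsub hP hf (s := s) hK.continuous h0 h1 he0.le hr.1 hφe
        (hae.mono fun x hx => hr.2 x hx) hη0).mono ?_
      have : α * (r - e) ≤ act (P s) φ y * (r - e) :=
        mul_le_mul_of_nonneg_right hs.le (by linarith)
      linarith
  have h2 := csInf_le hSbdd hmem
  have h3 : α * (sInf S - e) ≤ α * (r - e) := mul_le_mul_of_nonneg_left (by linarith) hα0.le
  linarith

/-- The e-property on the interior of the support, given equicontinuity of `P_t f` at each point
over every bounded set of times. -/
theorem hasEPropertyAt_of_mem_interior_support [SecondCountableTopology X] [CompleteSpace X]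
    (hsub : ∀ s n t : T, s + n ≤ t → ∃ u, n ≤ u ∧ t = s + u)
    (hP : IsMarkovFellerSemigroup P) (hec : ∀ z, IsEventuallyContinuousAt P z)
    (hμ : IsErgodicMeasure P μ)
    (hbdd : ∀ f : X → ℝ, IsBoundedLipschitz f → ∀ z, ∀ n : T, ∀ ε > 0,
      ∀ᶠ x in 𝓝 z, ∀ t ≤ n, |act (P t) f x - act (P t) f z| < ε)
    {z : X} (hz : z ∈ interior (μ : Measure X).support) : HasEPropertyAt P z := by
  intro f hf ε hε
  obtain ⟨⟨K, hK⟩, C, hC⟩ := id hf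
  have hfb : f ∈ boundedMeasurable X := mem_boundedMeasurable_of_continuous hK.continuous hC
  obtain ⟨V, hV, n, hn⟩ := isNearlyConstantAt_of_mem_support hsub hP hec hμ hfb
    (fun e he => exists_isNearlyConstantAt hP.markovFeller (hec z) hf
      (mem_interior_iff_mem_nhds.1 hz) he) (interior_subset hz) (ε := ε / 3) (by positivity)
  obtain ⟨δ, hδ, hball⟩ := Metric.mem_nhds_iff.1 (inter_mem hV (hbdd f hf z n ε hε))
  refine ⟨δ, hδ, fun x hx t => ?_⟩
  rcases le_total t n with ht | ht
  · exact (hball hx).2 t ht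
  · obtain ⟨c, hc⟩ := hn t ht
    have h1 := abs_le.1 (hc x (hball hx).1)
    have h2 := abs_le.1 (hc z (mem_of_mem_nhds hV))
    exact abs_lt.2 ⟨by linarith, by linarith⟩

end EProperty

/-! ### Equicontinuity over bounded sets of times -/

section BoundedTimes

variable {X : Type*} [MetricSpace X] [MeasurableSpace X]

theorem eventually_abs_act_sub_lt {P : FiniteMeasure X → FiniteMeasure X}
    (hP : IsMarkovFellerOperator P) {f : X → ℝ} (hf : IsBoundedLipschitz f) (z : X) {ε : ℝ}
    (hε : 0 < ε) : ∀ᶠ x in 𝓝 z, |act P f x - act P f z| < ε := by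
  obtain ⟨⟨K, hK⟩, C, hC⟩ := hf
  have hc := (continuous_act hP hK.continuous hC).tendsto z
  exact Metric.tendsto_nhds.1 hc ε hε

variable [BorelSpace X]

/-- In continuous time, `P_t f` is uniformly close to one of finitely many `P_{jh} f` when `t` is
bounded, by strong continuity at `0` and the contraction property. -/
theorem eventually_forall_le_abs_act_sub_lt {P : ℝ≥0 → FiniteMeasure X → FiniteMeasure X}
    (hP : IsMarkovFellerSemigroup P) (hsc : IsStronglyContinuous P) {f : X → ℝ}
    (hf : IsBoundedLipschitz f) (z : X) (n : ℝ≥0) {ε : ℝ} (hε : 0 < ε) :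
    ∀ᶠ x in 𝓝 z, ∀ t ≤ n, |act (P t) f x - act (P t) f z| < ε := by
  obtain ⟨⟨K, hK⟩, C, hC⟩ := id hf
  have hfb : f ∈ boundedMeasurable X := mem_boundedMeasurable_of_continuous hK.continuous hC
  have hM := fun t => (hP.markovFeller t).markov
  have hε3 : 0 < ε / 3 := by positivity
  have hunif := Metric.tendstoUniformly_iff.1
    (hsc (BoundedContinuousFunction.ofNormedAddCommGroup f hK.continuous C hC)) (ε / 3) hε3
  obtain ⟨h, hh0, hh⟩ := mem_nhdsGT_iff_exists_Ioc_subset.1 hunif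
  have hh0 : 0 < h := hh0
  have hclose : ∀ u : ℝ≥0, 0 < u → u ≤ h → ∀ y, |act (P u) f y - f y| ≤ ε / 3 := by
    intro u hu0 huh y
    have := hh ⟨hu0, huh⟩ y
    rw [dist_comm, Real.dist_eq] at this
    exact this.le
  obtain ⟨N, hN⟩ := exists_nat_ge (n / h)
  have hfin : ∀ᶠ x in 𝓝 z, ∀ j ∈ Finset.range (N + 1),
      |act (P (j * h)) f x - act (P (j * h)) f z| < ε / 3 :=
    (Filter.eventually_all_finset _).2 fun j _ =>
      eventually_abs_act_sub_lt (hP.markovFeller _) hf z hε3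
  filter_upwards [hfin] with x hx t ht
  set j := ⌊t / h⌋₊ with hj
  have hjle : (j : ℝ≥0) * h ≤ t := by
    rw [← le_div_iff₀ hh0]; exact Nat.floor_le zero_le
  have hjlt : t < (j + 1) * h := by
    rw [← div_lt_iff₀ hh0]; exact Nat.lt_floor_add_one _
  have hjN : j ∈ Finset.range (N + 1) := by
    refine Finset.mem_range.2 (Nat.lt_succ_of_le (Nat.floor_le_of_le ?_))
    exact (div_le_div_of_nonneg_right ht hh0.le).trans hN
  obtain ⟨u, hu⟩ := exists_add_of_le hjle
  have huh : u ≤ h := by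
    have : (j : ℝ≥0) * h + u ≤ j * h + h := by
      rw [← hu]; exact hjlt.le.trans_eq (by ring)
    exact le_of_add_le_add_left this
  have hcmp : ∀ y, |act (P t) f y - act (P (j * h)) f y| ≤ ε / 3 := by
    intro y
    rcases eq_or_ne u 0 with rfl | hu0
    · rw [hu, add_zero, sub_self, abs_zero]; exact hε3.le
    · rw [hu, add_comm, act_semigroup hP u _ hfb, ← act_sub (hM _)
        (act_mem_boundedMeasurable (hP.markovFeller u).regular hfb) hfb]
      exact abs_act_le (hM _) (hclose u (pos_iff_ne_zero.2 hu0) huh) y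
  have h1 := abs_le.1 (hcmp x)
  have h2 := abs_le.1 (hcmp z)
  have h3 := abs_lt.1 (hx j hjN)
  exact abs_lt.2 ⟨by linarith, by linarith⟩

end BoundedTimes

end MarkovFeller

theorem theorem1 {X : Type*} [MetricSpace X] [CompleteSpace X]
    [TopologicalSpace.SeparableSpace X] [MeasurableSpace X] [BorelSpace X]
    (μ : ProbabilityMeasure X) (hint : (interior (μ : Measure X).support).Nonempty) :
    (∀ P : ℕ+ → FiniteMeasure X → FiniteMeasure X,
      MarkovFeller.IsMarkovFellerSemigroup P →
      (∀ z : X, MarkovFeller.IsEventuallyContinuousAt P z) →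
      MarkovFeller.IsErgodicMeasure P μ →
      ∀ z ∈ interior (μ : Measure X).support, MarkovFeller.HasEPropertyAt P z) ∧
    (∀ P : ℝ≥0 → FiniteMeasure X → FiniteMeasure X,
      MarkovFeller.IsMarkovFellerSemigroup P →
      MarkovFeller.IsStronglyContinuous P →
      (∀ z : X, MarkovFeller.IsEventuallyContinuousAt P z) →
      MarkovFeller.IsErgodicMeasure P μ →
      ∀ z ∈ interior (μ : Measure X).support, MarkovFeller.HasEPropertyAt P z) := by
  have hsec : SecondCountableTopology X := UniformSpace.secondCountable_of_separable X
  refine ⟨fun P hP hec hμ z hz => ?_, fun P hP hsc hec hμ z hz => ?_⟩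
  · refine MarkovFeller.hasEPropertyAt_of_mem_interior_support (fun s n t hst => ?_) hP hec hμ
      (fun f hf z n ε hε => ?_) hz
    · have hlt : s < t := (PNat.lt_add_right s n).trans_le hst
      refine ⟨t - s, ?_, (PNat.add_sub_of_lt hlt).symm⟩
      rw [← PNat.add_sub_of_lt hlt] at hst
      exact le_of_add_le_add_left hst
    · have := (Filter.eventually_all_finset (Finset.Iic n)).2 fun t _ =>
        MarkovFeller.eventually_abs_act_sub_lt (hP.markovFeller t) hf z hε
      exact this.mono fun x hx t ht => hx t (Finset.mem_Iic.2 ht)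
  · refine MarkovFeller.hasEPropertyAt_of_mem_interior_support (fun s n t hst => ?_) hP hec hμ
      (fun f hf z n ε hε => MarkovFeller.eventually_forall_le_abs_act_sub_lt hP hsc hf z n hε) hz
    obtain ⟨u, rfl⟩ := exists_add_of_le hst
    exact ⟨n + u, le_self_add, add_assoc s n u⟩
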